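/- Let $n,n_c,m\ge 0$ and $d_c\ge 1$ be integers, and let $f:\mathbb R^n\to\mathbb R^n$, $g:\mathbb R^n\to\mathbb R^{n\times m}$, $f_c:\mathbb R^{n_c}\to\mathbb R^{n_c}$, $g_c:\mathbb R^{n_c}\to\mathbb R^{n_c\times m}$, $h_c:\mathbb R^{n_c}\to\mathbb R^m$, $c:\mathbb R^n\to\mathbb R^m$ and $Q:\mathbb R^n\to\mathbb R^{m\times m}$ be locally Lipschitz, with $Q(x)$ symmetric positive definite for every $x$. Put $$J(x,u)=\tfrac12 u^{T}Q(x)u+c(x)^{T}u,\qquad u_d(x,x_c)=-Q(x)^{-1}c(x).$$ Assume that $f,g,f_c$ are of class $C^{d_c-1}$ and that $h_c$ and $x\mapsto Q(x)^{-1}c(x)$ are of class $C^{d_c}$. For a differentiable map $\eta$ with Jacobian $\eta'$ write $L_\psi\eta=\eta'\psi$, and $L_\psi^{0}\eta=\eta$, $L_\psi^{i}\eta=L_\psi L_\psi^{i-1}\eta$ if $\psi$ is a vector field. Assume condition (C1): for all $x_c\in\mathbb R^{n_c}$, $L_{g_c}L_{f_c}^{i}h_c(x_c)=0$ for $0\le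 i\le d_c-2$, and the $m\times m$ matrix $L_{g_c}L_{f_c}^{d_c-1}h_c(x_c)$ is nonsingular. Let $\sigma_0,\dots,\sigma_{d_c-1}>0$ be such that all complex roots of $s^{d_c}+\sum_{i=0}^{d_c-1}\sigma_i s^{i}$ lie in the open left half-plane. With $\hat x=(x,x_c)$ and $\hat f(\hat x)=(f(x)+g(x)h_c(x_c),\,f_c(x_c))$, define the desired surrogate control $$\hat u_d(\hat x)=\bigl(L_{g_c}L_{f_c}^{d_c-1}h_c(x_c)\bigr)^{-1}\Bigl(L_{\hat f}^{d_c}u_d(\hat x)-L_{f_c}^{d_c}h_c(x_c)+\sum_{i=0}^{d_c-1}\sigma_i\bigl(L_{\hat f}^{i}u_d(\hat x)-L_{f_c}^{i}h_c(x_c)\bigr)\Bigr).$$ Consider solutions $\hat x=(x,x_c)$, on an interval $[0,T)$ with $0<T\le\infty$ and with $\hat x(0)=\hat x_0$, of the cascade $$\dot x=f(x)+g(x)u,\qquad \dot x_c=f_c(x_c)+g_c(x_c)\,\hat u_d(\hat x),\qquad u=h_c(x_c),$$ and put $e(t)=u(t)-u_d(\hat x(t))$. Then: (a) For every such solution, $e$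 is of class $C^{d_c}$ on $[0,T)$ and $e^{(d_c)}(t)+\sum_{i=0}^{d_c-1}\sigma_i e^{(i)}(t)=0$ for all $t\in[0,T)$. (b) There is $r>0$ such that for every $\hat x_0\in\mathbb R^n\times\mathbb R^{n_c}$ and every solution on some $[0,T)$ starting at $\hat x_0$ there is $K$ with $\|e(t)\|\le Ke^{-rt}$ for all $t\in[0,T)$; if $T=\infty$, then $\lim_{t\to\infty}e(t)=0$ (exponentially). (c) If $Q$ is bounded, then for every $\hat x_0$ and every solution on $[0,\infty)$ starting at $\hat x_0$, $\lim_{t\to\infty}\bigl[J(x(t),u(t))-J(x(t),u_d(\hat x(t)))\bigr]=0$. (d) If $\hat x_0=(x_0,x_{c0})$ satisfies $L_{f_c}^{i}h_c(x_{c0})=L_{\hat f}^{i}u_d(\hat x_0)$ for $i=0,\dots,d_c-1$, then every solution starting at $\hat x_0$ satisfies $u(t)=u_d(\hat x(t))$ for all $t\in[0,T)$. -/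

import Mathlib

open scoped Matrix Topology

namespace CascadeControl

noncomputable section

/-- The Jacobian matrix `η'(x)` of `η : ℝᵏ → ℝˡ`. -/
def jacobian {k l : ℕ} (η : (Fin k → ℝ) → (Fin l → ℝ)) (x : Fin k → ℝ) :
    Matrix (Fin l) (Fin k) ℝ :=
  LinearMap.toMatrix' (fderiv ℝ η x : (Fin k → ℝ) →ₗ[ℝ] (Fin l → ℝ))

/-- The Lie derivative `L_ψ η (x) = η'(x) ψ(x)` along a matrix-valued map `ψ : ℝᵏ → ℝ^{k × m}`. -/
def lieMat {k l m : ℕ} (ψ : (Fin k → ℝ) → Matrix (Fin k) (Fin m) ℝ)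
    (η : (Fin k → ℝ) → (Fin l → ℝ)) (x : Fin k → ℝ) : Matrix (Fin l) (Fin m) ℝ :=
  jacobian η x * ψ x

/-- The Lie derivative `L_ψ η (x) = η'(x) ψ(x)` along a vector field `ψ`.
The iterated Lie derivative `L_ψ^i η` is `(lieDeriv ψ)^[i] η`. -/
def lieDeriv {E F : Type*} [NormedAddCommGroup E] [NormedSpace ℝ E]
    [NormedAddCommGroup F] [NormedSpace ℝ F] (ψ : E → E) (η : E → F) : E → F :=
  fun x => fderiv ℝ η x (ψ x)

/-- The drift of the cascade, `f̂(x, x_c) = (f(x) + g(x) h_c(x_c), f_c(x_c))`. The cascade state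
`x̂ = (x, x_c)` is an element of `ℝⁿ × ℝ^{n_c}`. -/
def cascadeDrift {n nc m : ℕ} (f : (Fin n → ℝ) → (Fin n → ℝ))
    (g : (Fin n → ℝ) → Matrix (Fin n) (Fin m) ℝ)
    (fc : (Fin nc → ℝ) → (Fin nc → ℝ)) (hc : (Fin nc → ℝ) → (Fin m → ℝ)) :
    (Fin n → ℝ) × (Fin nc → ℝ) → (Fin n → ℝ) × (Fin nc → ℝ) :=
  fun p => (f p.1 + g p.1 *ᵥ hc p.2, fc p.2)

/-- The input term of the cascade, `ĝ(x, x_c) v = (0, g_c(x_c) v)`. -/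
def cascadeInput {n nc m : ℕ} (gc : (Fin nc → ℝ) → Matrix (Fin nc) (Fin m) ℝ)
    (p : (Fin n → ℝ) × (Fin nc → ℝ)) (v : Fin m → ℝ) : (Fin n → ℝ) × (Fin nc → ℝ) :=
  (0, gc p.2 *ᵥ v)

/-- `h_c` has relative degree `d_c ≥ 1` for the control dynamics: `L_{g_c} L_{f_c}^i h_c = 0` for
`i = 0, …, d_c - 2` and `L_{g_c} L_{f_c}^{d_c - 1} h_c` is nonsingular, everywhere. -/
def HasRelDegree {nc m : ℕ} (fc : (Fin nc → ℝ) → (Fin nc → ℝ))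
    (gc : (Fin nc → ℝ) → Matrix (Fin nc) (Fin m) ℝ) (hc : (Fin nc → ℝ) → (Fin m → ℝ))
    (dc : ℕ) : Prop :=
  0 < dc ∧
  (∀ (xc : Fin nc → ℝ) (i : ℕ), i + 2 ≤ dc → lieMat gc ((lieDeriv fc)^[i] hc) xc = 0) ∧
  (∀ xc : Fin nc → ℝ, IsUnit (lieMat gc ((lieDeriv fc)^[dc - 1] hc) xc))

/-- The cost `J(x, u) = ½ uᵀ Q(x) u + c(x)ᵀ u`. -/
def cost {n m : ℕ} (Q : (Fin n → ℝ) → Matrix (Fin m) (Fin m) ℝ)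
    (c : (Fin n → ℝ) → (Fin m → ℝ)) (x : Fin n → ℝ) (u : Fin m → ℝ) : ℝ :=
  1 / 2 * (u ⬝ᵥ (Q x *ᵥ u)) + c x ⬝ᵥ u

/-- The desired control `u_d(x̂) = -Q(x)⁻¹ c(x)`, as a function of `x̂ = (x, x_c)`. -/
def desiredControl {n nc m : ℕ} (Q : (Fin n → ℝ) → Matrix (Fin m) (Fin m) ℝ)
    (c : (Fin n → ℝ) → (Fin m → ℝ)) : (Fin n → ℝ) × (Fin nc → ℝ) → (Fin m → ℝ) :=
  fun p => -((Q p.1)⁻¹ *ᵥ c p.1)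

/-- The desired surrogate control `û_d`. -/
def desiredSurrogate {n nc m : ℕ} (f : (Fin n → ℝ) → (Fin n → ℝ))
    (g : (Fin n → ℝ) → Matrix (Fin n) (Fin m) ℝ)
    (fc : (Fin nc → ℝ) → (Fin nc → ℝ)) (gc : (Fin nc → ℝ) → Matrix (Fin nc) (Fin m) ℝ)
    (hc : (Fin nc → ℝ) → (Fin m → ℝ)) (Q : (Fin n → ℝ) → Matrix (Fin m) (Fin m) ℝ)
    (c : (Fin n → ℝ) → (Fin m → ℝ)) (dc : ℕ) (σ : Fin dc → ℝ) :
    (Fin n → ℝ) × (Fin nc → ℝ) → (Fin m → ℝ) :=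
  fun p =>
    (lieMat gc ((lieDeriv fc)^[dc - 1] hc) p.2)⁻¹ *ᵥ
      ((lieDeriv (cascadeDrift f g fc hc))^[dc] (desiredControl Q c) p
          - (lieDeriv fc)^[dc] hc p.2
        + ∑ i : Fin dc, σ i •
            ((lieDeriv (cascadeDrift f g fc hc))^[(i : ℕ)] (desiredControl Q c) p
              - (lieDeriv fc)^[(i : ℕ)] hc p.2))

/-- The time interval `[0, T)`, where `T = ⊤` gives `[0, ∞)`. -/
def timeInterval (T : EReal) : Set ℝ := {t : ℝ | 0 ≤ t ∧ (t : EReal) < T}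

/-- `X` solves the cascade `x̂' = f̂(x̂) + ĝ(x̂) û(x̂)`, `x̂(0) = x̂₀`, on `[0, T)`
(with the right derivative at `0`), where `0 < T ≤ ∞`. -/
def IsCascadeSolution {n nc m : ℕ} (f : (Fin n → ℝ) → (Fin n → ℝ))
    (g : (Fin n → ℝ) → Matrix (Fin n) (Fin m) ℝ)
    (fc : (Fin nc → ℝ) → (Fin nc → ℝ)) (gc : (Fin nc → ℝ) → Matrix (Fin nc) (Fin m) ℝ)
    (hc : (Fin nc → ℝ) → (Fin m → ℝ))
    (uhat : (Fin n → ℝ) × (Fin nc → ℝ) → (Fin m → ℝ))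
    (x₀ : (Fin n → ℝ) × (Fin nc → ℝ)) (T : EReal)
    (X : ℝ → (Fin n → ℝ) × (Fin nc → ℝ)) : Prop :=
  0 < T ∧ X 0 = x₀ ∧
  ∀ t ∈ timeInterval T,
    HasDerivWithinAt X (cascadeDrift f g fc hc (X t) + cascadeInput gc (X t) (uhat (X t)))
      (timeInterval T) t

/-- The error `e(t) = u(t) - u_d(x̂(t))` along a trajectory, with `u(t) = h_c(x_c(t))`. -/
def controlError {n nc m : ℕ} (hc : (Fin nc → ℝ) → (Fin m → ℝ))
    (Q : (Fin n → ℝ) → Matrix (Fin m) (Fin m) ℝ) (c : (Fin n → ℝ) → (Fin m → ℝ))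
    (X : ℝ → (Fin n → ℝ) × (Fin nc → ℝ)) (t : ℝ) : Fin m → ℝ :=
  hc (X t).2 - desiredControl Q c (X t)

end

end CascadeControl

/-! The iterated Lie derivative `L_{f̂}^k u_d` depends on `x` and on `h_c, …, L_{f_c}^{k-1} h_c`
only, and below the relative degree none of the latter feels the input. Hence the derivatives of `e`
of order `i < d_c` are `L_{f_c}^i h_c - L_{f̂}^i u_d`, the one of order `d_c` is affine in the
input, and `û_d` is the input that makes it equal to `-∑ σ_i e^{(i)}`. Splitting off the roots of
the characteristic polynomial one at a time bounds the solutions of this equation by `exp (-r t)`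
times the size of their initial jet, which vanishes for matching initial data. Finally `Q u_d = -c`
makes the excess cost `½ eᵀ Q e`. -/

namespace CascadeControl

section LieDerivatives

variable {E F : Type*} [NormedAddCommGroup E] [NormedSpace ℝ E]
  [NormedAddCommGroup F] [NormedSpace ℝ F] {ψ : E → E} {η : E → F}

theorem contDiff_iterate_lieDeriv {d i : ℕ} (hψ : ContDiff ℝ ((d - 1 : ℕ) : WithTop ℕ∞) ψ)
    (hη : ContDiff ℝ (d : WithTop ℕ∞) η) (hi : i ≤ d) :
    ContDiff ℝ ((d - i : ℕ) : WithTop ℕ∞) ((lieDeriv ψ)^[i] η) := by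
  induction i with
  | zero => simpa using hη
  | succ i ih =>
    rw [Function.iterate_succ_apply']
    have hfderiv : ContDiff ℝ ((d - (i + 1) : ℕ) : WithTop ℕ∞) (fderiv ℝ ((lieDeriv ψ)^[i] η)) :=
      (ih (by omega)).fderiv_right (by exact_mod_cast (by omega : d - (i + 1) + 1 ≤ d - i))
    exact hfderiv.clm_apply (hψ.of_le (by exact_mod_cast (by omega : d - (i + 1) ≤ d - 1)))

theorem differentiable_iterate_lieDeriv {d i : ℕ}
    (hψ : ContDiff ℝ ((d - 1 : ℕ) : WithTop ℕ∞) ψ) (hη : ContDiff ℝ (d : WithTop ℕ∞) η)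
    (hi : i < d) : Differentiable ℝ ((lieDeriv ψ)^[i] η) :=
  (contDiff_iterate_lieDeriv hψ hη hi.le).differentiable
    (by exact_mod_cast (by omega : d - i ≠ 0))

theorem hasDerivWithinAt_iterate_lieDeriv_comp {i : ℕ} {X : ℝ → E} {S : Set ℝ} {t : ℝ} {w : E}
    (hη : DifferentiableAt ℝ ((lieDeriv ψ)^[i] η) (X t))
    (hX : HasDerivWithinAt X (ψ (X t) + w) S t) :
    HasDerivWithinAt (fun s => (lieDeriv ψ)^[i] η (X s))
      ((lieDeriv ψ)^[i + 1] η (X t) + fderiv ℝ ((lieDeriv ψ)^[i] η) (X t) w) S t := by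
  refine (hη.hasFDerivAt.comp_hasDerivWithinAt t hX).congr_deriv ?_
  rw [map_add, Function.iterate_succ_apply', lieDeriv]

end LieDerivatives

section SeriesInterconnection

variable {E Z U F : Type*} [NormedAddCommGroup E] [NormedSpace ℝ E]
  [NormedAddCommGroup Z] [NormedSpace ℝ Z] [NormedAddCommGroup U] [NormedSpace ℝ U]
  [NormedAddCommGroup F] [NormedSpace ℝ F]
  {Ψ : E × U → E} {φ : Z → Z} {h : Z → U} {η : E → F}

/-- The vector field of the series interconnection of `z' = φ(z)`, `u = h(z)` with the plant
`x' = Ψ(x, u)`. -/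
def seriesField (Ψ : E × U → E) (φ : Z → Z) (h : Z → U) (p : E × Z) : E × Z :=
  (Ψ (p.1, h p.2), φ p.2)

/-- The plant state `x` together with `h(z), L_φ h(z), …, L_φ^{k-1} h(z)`, the first `k` derivatives
of the plant input along the unforced flow of `φ`. -/
noncomputable def inputJet (φ : Z → Z) (h : Z → U) (k : ℕ) (p : E × Z) : E × (Fin k → U) :=
  (p.1, fun j => (lieDeriv φ)^[j] h p.2)

theorem contDiff_seriesField {N : WithTop ℕ∞} (hΨ : ContDiff ℝ N Ψ) (hφ : ContDiff ℝ N φ)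
    (hh : ContDiff ℝ N h) : ContDiff ℝ N (seriesField Ψ φ h) :=
  (hΨ.comp (contDiff_fst.prodMk (hh.comp contDiff_snd))).prodMk (hφ.comp contDiff_snd)

theorem hasFDerivAt_inputJet {k : ℕ} {p : E × Z}
    (hh : ∀ j < k, DifferentiableAt ℝ ((lieDeriv φ)^[j] h) p.2) :
    HasFDerivAt (inputJet (E := E) φ h k)
      ((ContinuousLinearMap.fst ℝ E Z).prod (ContinuousLinearMap.pi fun j : Fin k =>
        (fderiv ℝ ((lieDeriv φ)^[j] h) p.2).comp (ContinuousLinearMap.snd ℝ E Z))) p :=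
  hasFDerivAt_fst.prodMk
    (hasFDerivAt_pi.2 fun j => (hh j j.2).hasFDerivAt.comp p hasFDerivAt_snd)

theorem exists_contDiff_comp_inputJet_eq_iterate_lieDeriv {d k : ℕ}
    (hΨ : ContDiff ℝ ((d - 1 : ℕ) : WithTop ℕ∞) Ψ) (hφ : ContDiff ℝ ((d - 1 : ℕ) : WithTop ℕ∞) φ)
    (hh : ContDiff ℝ (d : WithTop ℕ∞) h) (hη : ContDiff ℝ (d : WithTop ℕ∞) η) (hk : k ≤ d) :
    ∃ Φ : E × (Fin k → U) → F, ContDiff ℝ ((d - k : ℕ) : WithTop ℕ∞) Φ ∧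
      Φ ∘ inputJet φ h k = (lieDeriv (seriesField Ψ φ h))^[k] (fun p => η p.1) := by
  induction k with
  | zero => exact ⟨fun q => η q.1, hη.comp contDiff_fst, rfl⟩
  | succ k ih =>
    obtain ⟨Φ, hΦ, hΦ_eq⟩ := ih (by omega)
    have hΦ' : ContDiff ℝ ((d - (k + 1) : ℕ) : WithTop ℕ∞) (fderiv ℝ Φ) :=
      hΦ.fderiv_right (by exact_mod_cast (by omega : d - (k + 1) + 1 ≤ d - k))
    have hΨ' : ContDiff ℝ ((d - (k + 1) : ℕ) : WithTop ℕ∞) Ψ :=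
      hΨ.of_le (by exact_mod_cast (by omega : d - (k + 1) ≤ d - 1))
    refine ⟨fun q => fderiv ℝ Φ (q.1, Fin.init q.2) (Ψ (q.1, q.2 0), Fin.tail q.2), ?_, ?_⟩
    · unfold Fin.init Fin.tail
      exact (hΦ'.comp (by fun_prop)).clm_apply ((hΨ'.comp (by fun_prop)).prodMk (by fun_prop))
    · funext p
      have hjet := hasFDerivAt_inputJet (E := E) (p := p) fun j (hj : j < k) =>
        differentiable_iterate_lieDeriv hφ hh (by omega) p.2
      have hΦd : DifferentiableAt ℝ Φ (inputJet φ h k p) :=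
        hΦ.differentiable (by exact_mod_cast (by omega : d - k ≠ 0)) _
      rw [Function.iterate_succ_apply', ← hΦ_eq, lieDeriv, (hΦd.hasFDerivAt.comp p hjet).fderiv]
      change fderiv ℝ Φ _ (_, fun j : Fin k => (lieDeriv φ)^[j + 1] h p.2) = _
      simp only [Function.iterate_succ_apply']
      rfl

/-- `L^k` of a function of the plant state only sees `h, …, L_φ^{k-1} h`, and none of these feels a
perturbation `w` of `φ` as long as `k` is below the relative degree. -/
theorem fderiv_iterate_lieDeriv_seriesField_apply_eq_zero {d k : ℕ}
    (hΨ : ContDiff ℝ ((d - 1 : ℕ) : WithTop ℕ∞) Ψ) (hφ : ContDiff ℝ ((d - 1 : ℕ) : WithTop ℕ∞) φ)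
    (hh : ContDiff ℝ (d : WithTop ℕ∞) h) (hη : ContDiff ℝ (d : WithTop ℕ∞) η) (hk : k < d)
    {p : E × Z} {w : Z} (hw : ∀ j < k, fderiv ℝ ((lieDeriv φ)^[j] h) p.2 w = 0) :
    fderiv ℝ ((lieDeriv (seriesField Ψ φ h))^[k] (fun p => η p.1)) p (0, w) = 0 := by
  obtain ⟨Φ, hΦ, hΦ_eq⟩ :=
    exists_contDiff_comp_inputJet_eq_iterate_lieDeriv hΨ hφ hh hη hk.le
  have hjet := hasFDerivAt_inputJet (E := E) (p := p) fun j (hj : j < k) =>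
    differentiable_iterate_lieDeriv hφ hh (by omega) p.2
  have hΦd : DifferentiableAt ℝ Φ (inputJet φ h k p) :=
    hΦ.differentiable (by exact_mod_cast (by omega : d - k ≠ 0)) _
  rw [← hΦ_eq, (hΦd.hasFDerivAt.comp p hjet).fderiv, ContinuousLinearMap.comp_apply]
  convert map_zero (fderiv ℝ Φ (inputJet φ h k p))
  exact Prod.ext rfl (funext fun j => hw j j.2)

end SeriesInterconnection

section Jets

variable {𝕜 F G : Type*} [NontriviallyNormedField 𝕜] [NormedAddCommGroup F] [NormedSpace 𝕜 F]
  [NormedAddCommGroup G] [NormedSpace 𝕜 G] {d : ℕ} {y : ℕ → 𝕜 → F} {S : Set 𝕜}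

/-- `y 0, …, y d` are successive derivatives on `S`; the `y i` with `i > d` are arbitrary. -/
def IsJetOn (d : ℕ) (y : ℕ → 𝕜 → F) (S : Set 𝕜) : Prop :=
  ∀ i < d, ∀ t ∈ S, HasDerivWithinAt (y i) (y (i + 1) t) S t

theorem IsJetOn.mono {S' : Set 𝕜} (hy : IsJetOn d y S) (hS : S' ⊆ S) : IsJetOn d y S' :=
  fun i hi t ht => (hy i hi t (hS ht)).mono hS

theorem IsJetOn.clm_comp (L : F →L[𝕜] G) (hy : IsJetOn d y S) :
    IsJetOn d (fun i t => L (y i t)) S :=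
  fun i hi t ht => L.hasFDerivAt.comp_hasDerivWithinAt t (hy i hi t ht)

theorem IsJetOn.iteratedDerivWithin_eq (hy : IsJetOn d y S) (hS : UniqueDiffOn 𝕜 S) {i : ℕ}
    (hi : i ≤ d) : Set.EqOn (iteratedDerivWithin i (y 0) S) (y i) S := by
  induction i with
  | zero => exact fun t _ => congrFun iteratedDerivWithin_zero t
  | succ i ih =>
    intro t ht
    have hi_eq := ih (by omega)
    rw [iteratedDerivWithin_succ, derivWithin_congr hi_eq (hi_eq ht)]
    exact (hy i hi t ht).derivWithin (hS t ht)

theorem IsJetOn.contDiffOn (hy : IsJetOn d y S) (hS : UniqueDiffOn 𝕜 S)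
    (hcont : ContinuousOn (y d) S) : ContDiffOn 𝕜 (d : WithTop ℕ∞) (y 0) S := by
  refine contDiffOn_of_continuousOn_differentiableOn_deriv (n := d) (fun i hi => ?_)
    fun i hi => ?_
  · have hid : i ≤ d := by exact_mod_cast hi
    refine ContinuousOn.congr ?_ (hy.iteratedDerivWithin_eq hS hid)
    rcases hid.eq_or_lt with rfl | hlt
    exacts [hcont, fun t ht => (hy i hlt t ht).continuousWithinAt]
  · have hid : i < d := by exact_mod_cast hi
    exact DifferentiableOn.congr (fun t ht => (hy i hid t ht).differentiableWithinAt)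
      (hy.iteratedDerivWithin_eq hS hid.le)

end Jets

section ExponentialDecay

open Polynomial Set

variable {V : Type*} [NormedAddCommGroup V] [NormedSpace ℂ V]

theorem norm_exp_mul_ofReal (a : ℂ) (t : ℝ) :
    ‖Complex.exp (a * t)‖ = Real.exp (a.re * t) := by
  simp [Complex.norm_exp]

theorem hasDerivWithinAt_exp_neg_mul_smul {a : ℂ} {Y : ℝ → V} {z : V} {S : Set ℝ} {t : ℝ}
    (hY : HasDerivWithinAt Y (a • Y t + z) S t) :
    HasDerivWithinAt (fun s : ℝ => Complex.exp (-a * s) • Y s) (Complex.exp (-a * t) • z) S t := by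
  have hlin : HasDerivAt (fun s : ℝ => -a * (s : ℂ)) (-a) t := by
    simpa using (Complex.ofRealCLM.hasDerivAt (x := t)).const_mul (-a)
  refine (hlin.cexp.hasDerivWithinAt.smul hY).congr_deriv ?_
  module

theorem norm_le_of_hasDerivWithinAt_smul_add {a : ℂ} {r K τ : ℝ} (ha : a.re < -r) (hK : 0 ≤ K)
    {Y Z : ℝ → V}
    (hY : ∀ t ∈ Icc 0 τ, HasDerivWithinAt Y (a • Y t + Z t) (Icc 0 τ) t)
    (hZ : ∀ t ∈ Icc 0 τ, ‖Z t‖ ≤ K * Real.exp (-r * t)) {t : ℝ} (ht : t ∈ Icc 0 τ) :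
    ‖Y t‖ ≤ (‖Y 0‖ + K / (-a.re - r)) * Real.exp (-r * t) := by
  set δ := -a.re - r with hδ
  have hδ0 : 0 < δ := by linarith
  set G : ℝ → V := fun s => Complex.exp (-a * s) • Y s with hG
  have hG' := fun s hs => hasDerivWithinAt_exp_neg_mul_smul (hY s hs)
  have hB (s : ℝ) : HasDerivAt (fun s => ‖Y 0‖ + K / δ * Real.exp (δ * s))
      (K * Real.exp (δ * s)) s := by
    refine (((hasDerivAt_id s).const_mul δ).exp.const_mul (K / δ)).const_add ‖Y 0‖
      |>.congr_deriv ?_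
    field_simp
    simp
  have hGt : ‖G t‖ ≤ ‖Y 0‖ + K / δ * Real.exp (δ * t) := by
    refine image_norm_le_of_norm_deriv_right_le_deriv_boundary
      (fun s hs => (hG' s hs).continuousWithinAt)
      (fun s hs => (hG' s (Ico_subset_Icc_self hs)).mono_of_mem_nhdsWithin
        (Icc_mem_nhdsGE_of_mem hs)) ?_ hB (fun s hs => ?_) ht
    · simp only [Complex.ofReal_zero, mul_zero, Complex.exp_zero, one_smul, Real.exp_zero, mul_one]
      exact le_add_of_nonneg_right (by positivity)
    · calc ‖Complex.exp (-a * s) • Z s‖ = Real.exp (-a.re * s) * ‖Z s‖ := by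
            rw [norm_smul, norm_exp_mul_ofReal, Complex.neg_re]
        _ ≤ Real.exp (-a.re * s) * (K * Real.exp (-r * s)) := by
            gcongr
            exact hZ s (Ico_subset_Icc_self hs)
        _ = K * Real.exp (δ * s) := by
            rw [mul_left_comm, ← Real.exp_add, hδ]
            ring_nf
  calc ‖Y t‖ = Real.exp (a.re * t) * ‖G t‖ := by
        rw [hG, norm_smul, norm_exp_mul_ofReal, ← mul_assoc, ← Real.exp_add]
        simp
    _ ≤ Real.exp (a.re * t) * (‖Y 0‖ + K / δ * Real.exp (δ * t)) := by gcongr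
    _ = ‖Y 0‖ * Real.exp (a.re * t) + K / δ * Real.exp (-r * t) := by
        rw [mul_add, mul_left_comm, ← Real.exp_add, hδ]
        ring_nf
    _ ≤ (‖Y 0‖ + K / δ) * Real.exp (-r * t) := by
        rw [add_mul]
        gcongr
        exact ht.1

/-- The shift of sequences of `V`-valued functions. On a sequence of successive derivatives `y` it
is differentiation, so that `aeval (jetShift V) p y 0` is `p(d/dt) y₀`. -/
def jetShift (V : Type*) [AddCommGroup V] [Module ℂ V] : Module.End ℂ (ℕ → ℝ → V) :=
  LinearMap.funLeft ℂ (ℝ → V) (· + 1)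

theorem jetShift_pow_apply {W : Type*} [AddCommGroup W] [Module ℂ W] (k : ℕ) (y : ℕ → ℝ → W)
    (i : ℕ) : (jetShift W ^ k) y i = y (i + k) := by
  induction k generalizing y with
  | zero => rfl
  | succ k ih =>
    rw [pow_succ, Module.End.mul_apply, ih]
    rfl

theorem aeval_jetShift_X_pow_add_sum {W : Type*} [AddCommGroup W] [Module ℂ W] {d : ℕ}
    (σ : Fin d → ℂ) (y : ℕ → ℝ → W) (t : ℝ) :
    aeval (jetShift W) (X ^ d + ∑ i : Fin d, C (σ i) * X ^ (i : ℕ)) y 0 t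
      = y d t + ∑ i : Fin d, σ i • y i t := by
  simp [aeval_C, jetShift_pow_apply, LinearMap.sum_apply, Finset.sum_apply,
    Module.algebraMap_end_apply]

theorem sum_norm_succ_sub_smul_le {𝕜 W : Type*} [NormedField 𝕜] [SeminormedAddCommGroup W]
    [NormedSpace 𝕜 W] (a : 𝕜) (v : ℕ → W) (k : ℕ) :
    ∑ i ∈ Finset.range k, ‖v (i + 1) - a • v i‖
      ≤ (1 + ‖a‖) * ∑ i ∈ Finset.range (k + 1), ‖v i‖ := by
  calc ∑ i ∈ Finset.range k, ‖v (i + 1) - a • v i‖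
      ≤ ∑ i ∈ Finset.range k, (‖v (i + 1)‖ + ‖a‖ * ‖v i‖) :=
        Finset.sum_le_sum fun i _ => (norm_sub_le _ _).trans_eq (by rw [norm_smul])
    _ = ∑ i ∈ Finset.range k, ‖v (i + 1)‖ + ‖a‖ * ∑ i ∈ Finset.range k, ‖v i‖ := by
        rw [Finset.sum_add_distrib, Finset.mul_sum]
    _ ≤ ∑ i ∈ Finset.range (k + 1), ‖v i‖ + ‖a‖ * ∑ i ∈ Finset.range (k + 1), ‖v i‖ := by
        gcongr ?_ + ‖a‖ * ?_
        · rw [Finset.sum_range_succ' _ k]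
          exact le_add_of_nonneg_right (norm_nonneg _)
        · rw [Finset.sum_range_succ _ k]
          exact le_add_of_nonneg_right (norm_nonneg _)
    _ = (1 + ‖a‖) * ∑ i ∈ Finset.range (k + 1), ‖v i‖ := by ring

theorem norm_le_of_norm_succ_sub_smul_le {a : ℂ} {r M τ : ℝ} (ha : a.re < -r) (hM : 0 ≤ M)
    {y : ℕ → ℝ → V} {k : ℕ} (hy : ∀ t ∈ Icc 0 τ, HasDerivWithinAt (y 0) (y 1 t) (Icc 0 τ) t)
    (hz : ∀ t ∈ Icc 0 τ, ‖y 1 t - a • y 0 t‖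
      ≤ M * (∑ i ∈ Finset.range k, ‖y (i + 1) 0 - a • y i 0‖) * Real.exp (-r * t))
    {t : ℝ} (ht : t ∈ Icc 0 τ) :
    ‖y 0 t‖ ≤ (1 + M * (1 + ‖a‖) / (-a.re - r)) * (∑ i ∈ Finset.range (k + 1), ‖y i 0‖)
      * Real.exp (-r * t) := by
  have : 0 < -a.re - r := by linarith
  set N := ∑ i ∈ Finset.range (k + 1), ‖y i 0‖
  have hy_deriv : ∀ t ∈ Icc 0 τ,
      HasDerivWithinAt (y 0) (a • y 0 t + (y 1 t - a • y 0 t)) (Icc 0 τ) t :=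
    fun t ht => (hy t ht).congr_deriv (add_sub_cancel _ _).symm
  have hz_bound : ∀ t ∈ Icc 0 τ,
      ‖y 1 t - a • y 0 t‖ ≤ M * ((1 + ‖a‖) * N) * Real.exp (-r * t) := by
    intro t ht
    refine (hz t ht).trans ?_
    gcongr
    exact sum_norm_succ_sub_smul_le a (fun i => y i 0) k
  have hy_init : ‖y 0 0‖ ≤ N :=
    Finset.single_le_sum (f := fun i => ‖y i 0‖) (fun _ _ => norm_nonneg _) (by simp)
  calc ‖y 0 t‖
      ≤ (‖y 0 0‖ + M * ((1 + ‖a‖) * N) / (-a.re - r)) * Real.exp (-r * t) :=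
        norm_le_of_hasDerivWithinAt_smul_add ha (by positivity) hy_deriv hz_bound ht
    _ ≤ (N + M * ((1 + ‖a‖) * N) / (-a.re - r)) * Real.exp (-r * t) := by gcongr
    _ = (1 + M * (1 + ‖a‖) / (-a.re - r)) * N * Real.exp (-r * t) := by ring

/-- Splitting off one root at a time: if `p = q (X - a)`, then `z = y' - a y` solves
`q(d/dt) z = 0`, and `y` is recovered from `y' = a y + z`. -/
theorem exists_norm_le_of_aeval_jetShift_prod_eq_zero {r : ℝ} (s : Multiset ℂ)
    (hs : ∀ a ∈ s, a.re < -r) :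
    ∃ M : ℝ, 0 ≤ M ∧ ∀ (τ : ℝ) (y : ℕ → ℝ → V), IsJetOn s.card y (Icc 0 τ) →
      (∀ t ∈ Icc 0 τ, aeval (jetShift V) (s.map fun a => X - C a).prod y 0 t = 0) →
      ∀ t ∈ Icc 0 τ,
        ‖y 0 t‖ ≤ M * (∑ i ∈ Finset.range s.card, ‖y i 0‖) * Real.exp (-r * t) := by
  induction s using Multiset.induction_on with
  | empty =>
    refine ⟨0, le_rfl, fun τ y _ hy t ht => ?_⟩
    have hyt : y 0 t = 0 := by simpa using hy t ht
    simp [hyt]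
  | cons a s ih =>
    obtain ⟨M, hM, ih⟩ := ih fun b hb => hs b (Multiset.mem_cons_of_mem hb)
    have ha := hs a (Multiset.mem_cons_self a s)
    have hδ : 0 < -a.re - r := by linarith
    refine ⟨1 + M * (1 + ‖a‖) / (-a.re - r), by positivity, fun τ y hjet hy t ht => ?_⟩
    rw [Multiset.card_cons] at hjet ⊢
    let z : ℕ → ℝ → V := fun i t => y (i + 1) t - a • y i t
    have hz_jet : IsJetOn s.card z (Icc 0 τ) := fun i hi t ht =>
      (hjet (i + 1) (by omega) t ht).sub ((hjet i (by omega) t ht).const_smul a)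
    have hzy : aeval (jetShift V) (X - C a) y = z := by
      rw [map_sub, aeval_X, aeval_C]
      rfl
    have hz_ode : ∀ t ∈ Icc 0 τ, aeval (jetShift V) (s.map fun a => X - C a).prod z 0 t = 0 := by
      intro t ht
      rw [← hzy, ← Module.End.mul_apply, ← map_mul, mul_comm]
      simpa only [Multiset.map_cons, Multiset.prod_cons] using hy t ht
    exact norm_le_of_norm_succ_sub_smul_le ha hM (hjet 0 (by omega)) (ih τ z hz_jet hz_ode) ht

theorem exists_pos_forall_re_lt_neg (s : Finset ℂ) (hs : ∀ a ∈ s, a.re < 0) :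
    ∃ r : ℝ, 0 < r ∧ ∀ a ∈ s, a.re < -r := by
  have hev : ∀ᶠ r : ℝ in 𝓝[>] 0, ∀ a ∈ s, a.re < -r :=
    s.eventually_all.2 fun a ha => nhdsWithin_le_nhds <|
      (continuous_neg.tendsto' (0 : ℝ) 0 neg_zero).eventually_const_lt (hs a ha)
  obtain ⟨r, hr, hr0⟩ := (hev.and self_mem_nhdsWithin).exists
  exact ⟨r, hr0, hr⟩

theorem exists_norm_le_of_aeval_jetShift_eq_zero {p : ℂ[X]} (hp : p.Monic)
    (hroots : ∀ a, p.IsRoot a → a.re < 0) :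
    ∃ r M : ℝ, 0 < r ∧ ∀ (τ : ℝ) (y : ℕ → ℝ → V), IsJetOn p.natDegree y (Icc 0 τ) →
      (∀ t ∈ Icc 0 τ, aeval (jetShift V) p y 0 t = 0) →
      ∀ t ∈ Icc 0 τ,
        ‖y 0 t‖ ≤ M * (∑ i ∈ Finset.range p.natDegree, ‖y i 0‖) * Real.exp (-r * t) := by
  have hsplits := IsAlgClosed.splits p
  obtain ⟨r, hr, hlt⟩ := exists_pos_forall_re_lt_neg p.roots.toFinset fun a ha =>
    hroots a (isRoot_of_mem_roots (Multiset.mem_toFinset.1 ha))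
  obtain ⟨M, -, hM⟩ := exists_norm_le_of_aeval_jetShift_prod_eq_zero (V := V) p.roots fun a ha =>
    hlt a (Multiset.mem_toFinset.2 ha)
  rw [← hsplits.eq_prod_roots_of_monic hp, ← hsplits.natDegree_eq_card_roots] at hM
  exact ⟨r, M, hr, hM⟩

theorem exists_norm_le_of_hurwitz (ι : Type*) [Fintype ι] {d : ℕ} {σ : Fin d → ℝ}
    (hσ : ∀ s : ℂ, s ^ d + ∑ i : Fin d, (σ i : ℂ) * s ^ (i : ℕ) = 0 → s.re < 0) :
    ∃ r M : ℝ, 0 < r ∧ ∀ (τ : ℝ) (y : ℕ → ℝ → ι → ℝ), IsJetOn d y (Icc 0 τ) →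
      (∀ t ∈ Icc 0 τ, y d t + ∑ i : Fin d, σ i • y i t = 0) →
      ∀ t ∈ Icc 0 τ, ‖y 0 t‖ ≤ M * (∑ i ∈ Finset.range d, ‖y i 0‖) * Real.exp (-r * t) := by
  set p : ℂ[X] := X ^ d + ∑ i : Fin d, C (σ i : ℂ) * X ^ (i : ℕ) with hp
  have hdeg : (∑ i : Fin d, C (σ i : ℂ) * X ^ (i : ℕ)).degree < (d : WithBot ℕ) :=
    degree_sum_fin_lt fun i => (σ i : ℂ)
  have hnatDegree : p.natDegree = d := by
    rw [hp, natDegree_eq_of_degree_eq_some]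
    rw [degree_add_eq_left_of_degree_lt (by rwa [degree_X_pow]), degree_X_pow]
  obtain ⟨r, M, hr, hdecay⟩ := exists_norm_le_of_aeval_jetShift_eq_zero (V := ι → ℂ)
    (monic_X_pow_add hdeg) fun a ha => hσ a (by simpa [IsRoot, eval_finsetSum] using ha)
  rw [← hp, hnatDegree] at hdecay
  let κ : (ι → ℝ) →L[ℝ] (ι → ℂ) :=
    ContinuousLinearMap.pi fun j => Complex.ofRealCLM.comp (ContinuousLinearMap.proj j)
  have hκ_norm (v : ι → ℝ) : ‖κ v‖ = ‖v‖ := by simp [κ, Pi.norm_def]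
  refine ⟨r, M, hr, fun τ y hjet hode t ht => ?_⟩
  have hκ_ode : ∀ t ∈ Icc 0 τ, aeval (jetShift (ι → ℂ)) p (fun i t => κ (y i t)) 0 t = 0 :=
    fun t ht => by
      rw [hp, aeval_jetShift_X_pow_add_sum, ← map_zero κ, ← hode t ht, map_add, map_sum]
      simp only [map_smul, Complex.coe_smul]
  simpa only [hκ_norm] using hdecay τ _ (hjet.clm_comp κ) hκ_ode t ht

theorem tendsto_zero_of_norm_le_mul_exp {E : Type*} [NormedAddCommGroup E] {e : ℝ → E} {r K : ℝ}
    (hr : 0 < r) (he : ∀ t, 0 ≤ t → ‖e t‖ ≤ K * Real.exp (-r * t)) :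
    Filter.Tendsto e Filter.atTop (𝓝 0) := by
  have hexp : Filter.Tendsto (fun t : ℝ => K * Real.exp (-r * t)) Filter.atTop (𝓝 0) := by
    simpa using (Real.tendsto_exp_atBot.comp
      (Filter.tendsto_id.const_mul_atTop_of_neg (neg_neg_of_pos hr))).const_mul K
  exact squeeze_zero_norm' ((Filter.eventually_ge_atTop 0).mono he) hexp

end ExponentialDecay

section TimeInterval

theorem Icc_subset_timeInterval {T : EReal} {t : ℝ} (ht : t ∈ timeInterval T) :
    Set.Icc 0 t ⊆ timeInterval T :=
  fun _ hs => ⟨hs.1, (EReal.coe_le_coe_iff.2 hs.2).trans_lt ht.2⟩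

theorem uniqueDiffOn_timeInterval (T : EReal) : UniqueDiffOn ℝ (timeInterval T) := by
  induction T with
  | bot => simp [timeInterval, uniqueDiffOn_empty]
  | coe b => simpa [timeInterval, Set.Ico] using uniqueDiffOn_Ico (0 : ℝ) b
  | top => simpa [timeInterval, Set.Ici] using uniqueDiffOn_Ici (0 : ℝ)

end TimeInterval

section Matrices

open Matrix

theorem lieMat_mulVec {k l m : ℕ} (ψ : (Fin k → ℝ) → Matrix (Fin k) (Fin m) ℝ)
    (η : (Fin k → ℝ) → (Fin l → ℝ)) (x : Fin k → ℝ) (v : Fin m → ℝ) :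
    lieMat ψ η x *ᵥ v = fderiv ℝ η x (ψ x *ᵥ v) := by
  rw [lieMat, jacobian, ← mulVec_mulVec, LinearMap.toMatrix'_mulVec]
  rfl

theorem contDiff_mulVec {E ι κ : Type*} [NormedAddCommGroup E] [NormedSpace ℝ E] [Fintype ι]
    [Fintype κ] {N : WithTop ℕ∞} {A : E → Matrix ι κ ℝ} {v : E → κ → ℝ}
    (hA : ∀ i j, ContDiff ℝ N fun x => A x i j) (hv : ContDiff ℝ N v) :
    ContDiff ℝ N fun x => A x *ᵥ v x :=
  contDiff_pi.2 fun i => ContDiff.sum fun j _ => (hA i j).mul (contDiff_pi.1 hv j)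

theorem tendsto_dotProduct_mulVec_zero {α ι : Type*} [Fintype ι] {l : Filter α}
    {A : α → Matrix ι ι ℝ} {v : α → ι → ℝ} {M : ℝ} (hA : ∀ t i j, |A t i j| ≤ M)
    (hv : Filter.Tendsto v l (𝓝 0)) :
    Filter.Tendsto (fun t => v t ⬝ᵥ (A t *ᵥ v t)) l (𝓝 0) := by
  have hcoord (i : ι) : Filter.Tendsto (fun t => v t i) l (𝓝 0) := tendsto_pi_nhds.1 hv i
  have hAv (i : ι) : Filter.Tendsto (fun t => (A t *ᵥ v t) i) l (𝓝 0) := by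
    simpa [mulVec, dotProduct] using tendsto_finsetSum Finset.univ fun j _ =>
      bdd_le_mul_tendsto_zero' M (.of_forall fun t => hA t i j) (hcoord j)
  simpa [dotProduct] using tendsto_finsetSum Finset.univ fun i _ => (hcoord i).mul (hAv i)

theorem cost_sub_cost_of_mulVec_eq_neg {n m : ℕ} {Q : (Fin n → ℝ) → Matrix (Fin m) (Fin m) ℝ}
    {c : (Fin n → ℝ) → (Fin m → ℝ)} {x : Fin n → ℝ} (hQ : (Q x).IsSymm) {v : Fin m → ℝ}
    (hv : Q x *ᵥ v = -c x) (u : Fin m → ℝ) :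
    cost Q c x u - cost Q c x v = 1 / 2 * ((u - v) ⬝ᵥ (Q x *ᵥ (u - v))) := by
  have hsymm : v ⬝ᵥ (Q x *ᵥ u) = u ⬝ᵥ (Q x *ᵥ v) := by
    rw [← dotProduct_transpose_mulVec, hQ.eq]
  have hc : c x = -(Q x *ᵥ v) := by rw [hv, neg_neg]
  simp only [cost, hc, neg_dotProduct, dotProduct_comm (Q x *ᵥ v), mulVec_sub, sub_dotProduct,
    dotProduct_sub, hsymm]
  ring

end Matrices

section ErrorDynamics

variable {n nc m dc : ℕ} {f : (Fin n → ℝ) → (Fin n → ℝ)}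
  {g : (Fin n → ℝ) → Matrix (Fin n) (Fin m) ℝ} {fc : (Fin nc → ℝ) → (Fin nc → ℝ)}
  {gc : (Fin nc → ℝ) → Matrix (Fin nc) (Fin m) ℝ} {hc : (Fin nc → ℝ) → (Fin m → ℝ)}
  {Q : (Fin n → ℝ) → Matrix (Fin m) (Fin m) ℝ} {c : (Fin n → ℝ) → (Fin m → ℝ)}
  {σ : Fin dc → ℝ} {X : ℝ → (Fin n → ℝ) × (Fin nc → ℝ)}

/-- The difference `L_{f_c}^i h_c - L_{f̂}^i u_d` as a function of the cascade state: for `i < d_c`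
it is the `i`-th derivative of the control error. -/
noncomputable def lieError (f : (Fin n → ℝ) → (Fin n → ℝ))
    (g : (Fin n → ℝ) → Matrix (Fin n) (Fin m) ℝ)
    (fc : (Fin nc → ℝ) → (Fin nc → ℝ)) (hc : (Fin nc → ℝ) → (Fin m → ℝ))
    (Q : (Fin n → ℝ) → Matrix (Fin m) (Fin m) ℝ) (c : (Fin n → ℝ) → (Fin m → ℝ)) (i : ℕ)
    (p : (Fin n → ℝ) × (Fin nc → ℝ)) : Fin m → ℝ :=
  (lieDeriv fc)^[i] hc p.2 - (lieDeriv (cascadeDrift f g fc hc))^[i] (desiredControl Q c) p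

/-- The derivatives of order at most `d_c` of the control error along a trajectory `X` of the
closed loop. The one of order `d_c` involves the surrogate control, so it is not `lieError` at
`d_c`; its value is the one prescribed by the error equation. -/
noncomputable def errorJet (f : (Fin n → ℝ) → (Fin n → ℝ))
    (g : (Fin n → ℝ) → Matrix (Fin n) (Fin m) ℝ)
    (fc : (Fin nc → ℝ) → (Fin nc → ℝ)) (hc : (Fin nc → ℝ) → (Fin m → ℝ))
    (Q : (Fin n → ℝ) → Matrix (Fin m) (Fin m) ℝ) (c : (Fin n → ℝ) → (Fin m → ℝ))
    (σ : Fin dc → ℝ) (X : ℝ → (Fin n → ℝ) × (Fin nc → ℝ)) : ℕ → ℝ → Fin m → ℝ :=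
  Function.update (fun i t => lieError f g fc hc Q c i (X t)) dc
    fun t => -∑ i : Fin dc, σ i • lieError f g fc hc Q c i (X t)

theorem errorJet_of_lt {i : ℕ} (hi : i < dc) :
    errorJet f g fc hc Q c σ X i = fun t => lieError f g fc hc Q c i (X t) :=
  Function.update_of_ne hi.ne _ _

theorem errorJet_zero (hd : 0 < dc) : errorJet f g fc hc Q c σ X 0 = controlError hc Q c X :=
  errorJet_of_lt hd

theorem errorJet_self :
    errorJet f g fc hc Q c σ X dc
      = fun t => -∑ i : Fin dc, σ i • errorJet f g fc hc Q c σ X i t := by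
  simp only [fun i : Fin dc => errorJet_of_lt (f := f) (g := g) (fc := fc) (hc := hc) (Q := Q)
    (c := c) (σ := σ) (X := X) i.2]
  exact Function.update_self _ _ _

theorem errorJet_add_sum_eq_zero (t : ℝ) :
    errorJet f g fc hc Q c σ X dc t + ∑ i : Fin dc, σ i • errorJet f g fc hc Q c σ X i t = 0 := by
  rw [errorJet_self, neg_add_cancel]

theorem lieError_add_lieMat_mulVec_desiredSurrogate {p : (Fin n → ℝ) × (Fin nc → ℝ)}
    (hunit : IsUnit (lieMat gc ((lieDeriv fc)^[dc - 1] hc) p.2)) :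
    lieError f g fc hc Q c dc p
        + lieMat gc ((lieDeriv fc)^[dc - 1] hc) p.2 *ᵥ desiredSurrogate f g fc gc hc Q c dc σ p
      = -∑ i : Fin dc, σ i • lieError f g fc hc Q c i p := by
  rw [desiredSurrogate, Matrix.mulVec_mulVec,
    Matrix.mul_nonsing_inv _ ((Matrix.isUnit_iff_isUnit_det _).1 hunit), Matrix.one_mulVec,
    ← Finset.sum_neg_distrib]
  simp only [lieError, ← smul_neg, neg_sub]
  abel

/-- The surrogate control reaches `u_d` only through `h_c`, so below the relative degree it does not
enter the derivatives of `u_d`. -/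
theorem hasDerivWithinAt_lieError_comp
    (hfs : ContDiff ℝ ((dc - 1 : ℕ) : WithTop ℕ∞) f)
    (hgs : ∀ i j, ContDiff ℝ ((dc - 1 : ℕ) : WithTop ℕ∞) (fun x => g x i j))
    (hfcs : ContDiff ℝ ((dc - 1 : ℕ) : WithTop ℕ∞) fc)
    (hhcs : ContDiff ℝ (dc : WithTop ℕ∞) hc)
    (huds : ContDiff ℝ (dc : WithTop ℕ∞) (fun x => -((Q x)⁻¹ *ᵥ c x)))
    (hrel : HasRelDegree fc gc hc dc) {i : ℕ} (hi : i < dc) {S : Set ℝ} {t : ℝ} {w : Fin m → ℝ}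
    (hX : HasDerivWithinAt X (cascadeDrift f g fc hc (X t) + cascadeInput gc (X t) w) S t) :
    HasDerivWithinAt (fun s => lieError f g fc hc Q c i (X s))
      (lieError f g fc hc Q c (i + 1) (X t) + lieMat gc ((lieDeriv fc)^[i] hc) (X t).2 *ᵥ w)
      S t := by
  have hplant : ContDiff ℝ ((dc - 1 : ℕ) : WithTop ℕ∞)
      fun q : (Fin n → ℝ) × (Fin m → ℝ) => f q.1 + g q.1 *ᵥ q.2 :=
    (hfs.comp contDiff_fst).add
      (contDiff_mulVec (fun i j => (hgs i j).comp contDiff_fst) contDiff_snd)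
  have hdrift : ContDiff ℝ ((dc - 1 : ℕ) : WithTop ℕ∞) (cascadeDrift f g fc hc) :=
    contDiff_seriesField hplant hfcs (hhcs.of_le (by exact_mod_cast dc.sub_le 1))
  have hXc : HasDerivWithinAt (fun s => (X s).2) (fc (X t).2 + gc (X t).2 *ᵥ w) S t :=
    (hasFDerivAt_snd (𝕜 := ℝ) (p := X t)).comp_hasDerivWithinAt t hX
  have hoffset : fderiv ℝ ((lieDeriv (cascadeDrift f g fc hc))^[i] (desiredControl Q c)) (X t)
      (cascadeInput gc (X t) w) = 0 :=
    fderiv_iterate_lieDeriv_seriesField_apply_eq_zero hplant hfcs hhcs huds hi fun j hj => by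
      rw [← lieMat_mulVec, hrel.2.1 _ j (by omega), Matrix.zero_mulVec]
  have hu := hasDerivWithinAt_iterate_lieDeriv_comp
    (differentiable_iterate_lieDeriv hfcs hhcs hi (X t).2) hXc
  have hud := hasDerivWithinAt_iterate_lieDeriv_comp
    (differentiable_iterate_lieDeriv hdrift (huds.comp contDiff_fst) hi (X t)) hX
  refine (hu.sub hud).congr_deriv ?_
  change _ - (_ + fderiv ℝ ((lieDeriv (cascadeDrift f g fc hc))^[i] (desiredControl Q c)) (X t)
    (cascadeInput gc (X t) w)) = _
  rw [hoffset, ← lieMat_mulVec, lieError, add_zero, add_sub_right_comm]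
  rfl

theorem isJetOn_errorJet
    (hfs : ContDiff ℝ ((dc - 1 : ℕ) : WithTop ℕ∞) f)
    (hgs : ∀ i j, ContDiff ℝ ((dc - 1 : ℕ) : WithTop ℕ∞) (fun x => g x i j))
    (hfcs : ContDiff ℝ ((dc - 1 : ℕ) : WithTop ℕ∞) fc)
    (hhcs : ContDiff ℝ (dc : WithTop ℕ∞) hc)
    (huds : ContDiff ℝ (dc : WithTop ℕ∞) (fun x => -((Q x)⁻¹ *ᵥ c x)))
    (hrel : HasRelDegree fc gc hc dc) {x₀ : (Fin n → ℝ) × (Fin nc → ℝ)} {T : EReal}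
    (hX : IsCascadeSolution f g fc gc hc (desiredSurrogate f g fc gc hc Q c dc σ) x₀ T X) :
    IsJetOn dc (errorJet f g fc hc Q c σ X) (timeInterval T) := by
  intro i hi t ht
  rw [errorJet_of_lt hi]
  refine (hasDerivWithinAt_lieError_comp hfs hgs hfcs hhcs huds hrel hi
    (hX.2.2 t ht)).congr_deriv ?_
  by_cases hi' : i + 1 < dc
  · rw [hrel.2.1 _ i (by omega), Matrix.zero_mulVec, add_zero, errorJet_of_lt hi']
  · obtain rfl : dc = i + 1 := by omega
    rw [errorJet, Function.update_self]
    exact lieError_add_lieMat_mulVec_desiredSurrogate (hrel.2.2 _)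

theorem controlError_ode_of_isJetOn (hd : 0 < dc) {T : EReal}
    (hjet : IsJetOn dc (errorJet f g fc hc Q c σ X) (timeInterval T)) :
    ContDiffOn ℝ (dc : WithTop ℕ∞) (controlError hc Q c X) (timeInterval T) ∧
      ∀ t ∈ timeInterval T,
        iteratedDerivWithin dc (controlError hc Q c X) (timeInterval T) t
          + ∑ i : Fin dc, σ i •
              iteratedDerivWithin (i : ℕ) (controlError hc Q c X) (timeInterval T) t = 0 := by
  have hS := uniqueDiffOn_timeInterval T
  have hcont : ContinuousOn (errorJet f g fc hc Q c σ X dc) (timeInterval T) := by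
    rw [errorJet_self]
    exact (continuousOn_finsetSum _ fun (i : Fin dc) _ =>
      ContinuousOn.const_smul (fun t ht => (hjet i i.2 t ht).continuousWithinAt) (σ i)).neg
  rw [← errorJet_zero (f := f) (g := g) (fc := fc) (σ := σ) hd]
  refine ⟨hjet.contDiffOn hS hcont, fun t ht => ?_⟩
  rw [hjet.iteratedDerivWithin_eq hS le_rfl ht,
    Finset.sum_congr rfl fun i _ => by rw [hjet.iteratedDerivWithin_eq hS i.2.le ht]]
  exact errorJet_add_sum_eq_zero t

theorem exists_norm_controlError_le
    (hfs : ContDiff ℝ ((dc - 1 : ℕ) : WithTop ℕ∞) f)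
    (hgs : ∀ i j, ContDiff ℝ ((dc - 1 : ℕ) : WithTop ℕ∞) (fun x => g x i j))
    (hfcs : ContDiff ℝ ((dc - 1 : ℕ) : WithTop ℕ∞) fc)
    (hhcs : ContDiff ℝ (dc : WithTop ℕ∞) hc)
    (huds : ContDiff ℝ (dc : WithTop ℕ∞) (fun x => -((Q x)⁻¹ *ᵥ c x)))
    (hrel : HasRelDegree fc gc hc dc)
    (hσ : ∀ s : ℂ, s ^ dc + ∑ i : Fin dc, (σ i : ℂ) * s ^ (i : ℕ) = 0 → s.re < 0) :
    ∃ r M : ℝ, 0 < r ∧ ∀ x₀ T X,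
      IsCascadeSolution f g fc gc hc (desiredSurrogate f g fc gc hc Q c dc σ) x₀ T X →
      ∀ t ∈ timeInterval T, ‖controlError hc Q c X t‖
        ≤ M * (∑ i ∈ Finset.range dc, ‖lieError f g fc hc Q c i x₀‖) * Real.exp (-r * t) := by
  obtain ⟨r, M, hr, hdecay⟩ := exists_norm_le_of_hurwitz (Fin m) hσ
  refine ⟨r, M, hr, fun x₀ T X hX t ht => ?_⟩
  have hjet := (isJetOn_errorJet hfs hgs hfcs hhcs huds hrel hX).mono (Icc_subset_timeInterval ht)
  have hinit : ∑ i ∈ Finset.range dc, ‖errorJet f g fc hc Q c σ X i 0‖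
      = ∑ i ∈ Finset.range dc, ‖lieError f g fc hc Q c i x₀‖ :=
    Finset.sum_congr rfl fun i hi => by
      simp only [errorJet_of_lt (Finset.mem_range.1 hi), hX.2.1]
  rw [← errorJet_zero (f := f) (g := g) (fc := fc) (σ := σ) hrel.1, ← hinit]
  exact hdecay t _ hjet (fun s _ => errorJet_add_sum_eq_zero s) t ⟨ht.1, le_rfl⟩

theorem tendsto_cost_sub_cost_desiredControl (hQsymm : ∀ x, (Q x).IsSymm)
    (hQunit : ∀ x, IsUnit (Q x)) {M : ℝ} (hM : ∀ x i j, |Q x i j| ≤ M)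
    (he : Filter.Tendsto (controlError hc Q c X) Filter.atTop (𝓝 0)) :
    Filter.Tendsto
      (fun t => cost Q c (X t).1 (hc (X t).2) - cost Q c (X t).1 (desiredControl Q c (X t)))
      Filter.atTop (𝓝 0) := by
  have hcrit (p : (Fin n → ℝ) × (Fin nc → ℝ)) : Q p.1 *ᵥ desiredControl Q c p = -c p.1 := by
    rw [desiredControl, Matrix.mulVec_neg, Matrix.mulVec_mulVec,
      Matrix.mul_nonsing_inv _ ((Matrix.isUnit_iff_isUnit_det _).1 (hQunit _)), Matrix.one_mulVec]
  simp only [cost_sub_cost_of_mulVec_eq_neg (hQsymm _) (hcrit _)]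
  have hquad := (tendsto_dotProduct_mulVec_zero (fun t => hM (X t).1) he).const_mul (1 / 2 : ℝ)
  rw [mul_zero] at hquad
  exact hquad

end ErrorDynamics

end CascadeControl

open CascadeControl in
theorem mainTheorem7_general (n nc m dc : ℕ)
    (f : (Fin n → ℝ) → (Fin n → ℝ)) (g : (Fin n → ℝ) → Matrix (Fin n) (Fin m) ℝ)
    (fc : (Fin nc → ℝ) → (Fin nc → ℝ)) (gc : (Fin nc → ℝ) → Matrix (Fin nc) (Fin m) ℝ)
    (hc : (Fin nc → ℝ) → (Fin m → ℝ))
    (Q : (Fin n → ℝ) → Matrix (Fin m) (Fin m) ℝ) (c : (Fin n → ℝ) → (Fin m → ℝ))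
    (σ : Fin dc → ℝ)
    (hQsymm : ∀ x, (Q x).IsSymm) (hQunit : ∀ x, IsUnit (Q x))
    (hfs : ContDiff ℝ ((dc - 1 : ℕ) : WithTop ℕ∞) f)
    (hgs : ∀ i j, ContDiff ℝ ((dc - 1 : ℕ) : WithTop ℕ∞) (fun x => g x i j))
    (hfcs : ContDiff ℝ ((dc - 1 : ℕ) : WithTop ℕ∞) fc)
    (hhcs : ContDiff ℝ (dc : WithTop ℕ∞) hc)
    (huds : ContDiff ℝ (dc : WithTop ℕ∞) (fun x => -((Q x)⁻¹ *ᵥ c x)))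
    (hrel : HasRelDegree fc gc hc dc)
    (hσ : ∀ s : ℂ, s ^ dc + ∑ i : Fin dc, (σ i : ℂ) * s ^ (i : ℕ) = 0 → s.re < 0) :
    (∀ (x₀ : (Fin n → ℝ) × (Fin nc → ℝ)) (T : EReal) (X : ℝ → (Fin n → ℝ) × (Fin nc → ℝ)),
      IsCascadeSolution f g fc gc hc (desiredSurrogate f g fc gc hc Q c dc σ) x₀ T X →
        ContDiffOn ℝ (dc : WithTop ℕ∞) (controlError hc Q c X) (timeInterval T) ∧
        ∀ t ∈ timeInterval T,
          iteratedDerivWithin dc (controlError hc Q c X) (timeInterval T) t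
            + ∑ i : Fin dc, σ i •
                iteratedDerivWithin (i : ℕ) (controlError hc Q c X) (timeInterval T) t = 0) ∧
    (∃ r : ℝ, 0 < r ∧
      ∀ (x₀ : (Fin n → ℝ) × (Fin nc → ℝ)) (T : EReal) (X : ℝ → (Fin n → ℝ) × (Fin nc → ℝ)),
        IsCascadeSolution f g fc gc hc (desiredSurrogate f g fc gc hc Q c dc σ) x₀ T X →
          (∃ K : ℝ, ∀ t ∈ timeInterval T, ‖controlError hc Q c X t‖ ≤ K * Real.exp (-r * t)) ∧
          (T = ⊤ → Filter.Tendsto (controlError hc Q c X) Filter.atTop (𝓝 0))) ∧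
    ((∃ M : ℝ, ∀ x i j, |Q x i j| ≤ M) →
      ∀ (x₀ : (Fin n → ℝ) × (Fin nc → ℝ)) (X : ℝ → (Fin n → ℝ) × (Fin nc → ℝ)),
        IsCascadeSolution f g fc gc hc (desiredSurrogate f g fc gc hc Q c dc σ) x₀ ⊤ X →
          Filter.Tendsto
            (fun t => cost Q c (X t).1 (hc (X t).2) - cost Q c (X t).1 (desiredControl Q c (X t)))
            Filter.atTop (𝓝 0)) ∧
    (∀ (x₀ : (Fin n → ℝ) × (Fin nc → ℝ)) (T : EReal) (X : ℝ → (Fin n → ℝ) × (Fin nc → ℝ)),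
      IsCascadeSolution f g fc gc hc (desiredSurrogate f g fc gc hc Q c dc σ) x₀ T X →
        (∀ i : ℕ, i < dc →
          (lieDeriv fc)^[i] hc x₀.2 =
            (lieDeriv (cascadeDrift f g fc hc))^[i] (desiredControl Q c) x₀) →
        ∀ t ∈ timeInterval T, hc (X t).2 = desiredControl Q c (X t)) := by
  obtain ⟨r, M, hr, hbound⟩ := exists_norm_controlError_le hfs hgs hfcs hhcs huds hrel hσ
  have hlim : ∀ x₀ X,
      IsCascadeSolution f g fc gc hc (desiredSurrogate f g fc gc hc Q c dc σ) x₀ ⊤ X →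
      Filter.Tendsto (controlError hc Q c X) Filter.atTop (𝓝 0) := fun x₀ X hX =>
    tendsto_zero_of_norm_le_mul_exp hr fun t ht => hbound x₀ ⊤ X hX t ⟨ht, EReal.coe_lt_top t⟩
  refine ⟨fun x₀ T X hX => ?_, ⟨r, hr, fun x₀ T X hX => ⟨⟨_, hbound x₀ T X hX⟩, ?_⟩⟩, ?_, ?_⟩
  · exact controlError_ode_of_isJetOn hrel.1 (isJetOn_errorJet hfs hgs hfcs hhcs huds hrel hX)
  · rintro rfl
    exact hlim x₀ X hX
  · rintro ⟨B, hB⟩ x₀ X hX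
    exact tendsto_cost_sub_cost_desiredControl hQsymm hQunit hB (hlim x₀ X hX)
  · intro x₀ T X hX hmatch t ht
    have hinit : ∑ i ∈ Finset.range dc, ‖lieError f g fc hc Q c i x₀‖ = 0 :=
      Finset.sum_eq_zero fun i hi =>
        norm_eq_zero.2 (sub_eq_zero.2 (hmatch i (Finset.mem_range.1 hi)))
    have hnorm := hbound x₀ T X hX t ht
    rw [hinit, mul_zero, zero_mul, norm_le_zero_iff] at hnorm
    exact sub_eq_zero.1 hnorm

theorem mainTheorem7 (n nc m dc : ℕ)
    (f : (Fin n → ℝ) → (Fin n → ℝ)) (g : (Fin n → ℝ) → Matrix (Fin n) (Fin m) ℝ)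
    (fc : (Fin nc → ℝ) → (Fin nc → ℝ)) (gc : (Fin nc → ℝ) → Matrix (Fin nc) (Fin m) ℝ)
    (hc : (Fin nc → ℝ) → (Fin m → ℝ))
    (Q : (Fin n → ℝ) → Matrix (Fin m) (Fin m) ℝ) (c : (Fin n → ℝ) → (Fin m → ℝ))
    (σ : Fin dc → ℝ)
    -- the data are locally Lipschitz
    (hf : LocallyLipschitz f) (hg : ∀ i j, LocallyLipschitz (fun x => g x i j))
    (hfc : LocallyLipschitz fc) (hgc : ∀ i j, LocallyLipschitz (fun xc => gc xc i j))
    (hhc : LocallyLipschitz hc)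
    (hQ : ∀ i j, LocallyLipschitz (fun x => Q x i j)) (hcc : LocallyLipschitz c)
    -- `Q` takes values in the symmetric positive definite matrices
    (hQpos : ∀ x, (Q x).PosDef)
    -- smooth enough for the Lie derivatives that occur to exist and be continuous
    (hfs : ContDiff ℝ ((dc - 1 : ℕ) : WithTop ℕ∞) f)
    (hgs : ∀ i j, ContDiff ℝ ((dc - 1 : ℕ) : WithTop ℕ∞) (fun x => g x i j))
    (hfcs : ContDiff ℝ ((dc - 1 : ℕ) : WithTop ℕ∞) fc)
    (hhcs : ContDiff ℝ (dc : WithTop ℕ∞) hc)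
    (huds : ContDiff ℝ (dc : WithTop ℕ∞) (fun x => -((Q x)⁻¹ *ᵥ c x)))
    -- relative degree of the control dynamics
    (hrel : CascadeControl.HasRelDegree fc gc hc dc)
    -- the gains are positive and all roots of `σ(s)` lie in the open left half plane
    (hσpos : ∀ i, 0 < σ i)
    (hσ : ∀ s : ℂ, s ^ dc + ∑ i : Fin dc, (σ i : ℂ) * s ^ (i : ℕ) = 0 → s.re < 0) :
    -- the error equation
    (∀ (x₀ : (Fin n → ℝ) × (Fin nc → ℝ)) (T : EReal) (X : ℝ → (Fin n → ℝ) × (Fin nc → ℝ)),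
      CascadeControl.IsCascadeSolution f g fc gc hc
          (CascadeControl.desiredSurrogate f g fc gc hc Q c dc σ) x₀ T X →
        ContDiffOn ℝ (dc : WithTop ℕ∞) (CascadeControl.controlError hc Q c X)
          (CascadeControl.timeInterval T) ∧
        ∀ t ∈ CascadeControl.timeInterval T,
          iteratedDerivWithin dc (CascadeControl.controlError hc Q c X)
              (CascadeControl.timeInterval T) t
            + ∑ i : Fin dc, σ i •
                iteratedDerivWithin (i : ℕ) (CascadeControl.controlError hc Q c X)
                  (CascadeControl.timeInterval T) t = 0) ∧
    -- exponential convergence of the error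
    (∃ r : ℝ, 0 < r ∧
      ∀ (x₀ : (Fin n → ℝ) × (Fin nc → ℝ)) (T : EReal) (X : ℝ → (Fin n → ℝ) × (Fin nc → ℝ)),
        CascadeControl.IsCascadeSolution f g fc gc hc
            (CascadeControl.desiredSurrogate f g fc gc hc Q c dc σ) x₀ T X →
          (∃ K : ℝ, ∀ t ∈ CascadeControl.timeInterval T,
            ‖CascadeControl.controlError hc Q c X t‖ ≤ K * Real.exp (-r * t)) ∧
          (T = ⊤ →
            Filter.Tendsto (CascadeControl.controlError hc Q c X) Filter.atTop (𝓝 0))) ∧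
    -- convergence of the cost, for bounded `Q`
    ((∃ M : ℝ, ∀ x i j, |Q x i j| ≤ M) →
      ∀ (x₀ : (Fin n → ℝ) × (Fin nc → ℝ)) (X : ℝ → (Fin n → ℝ) × (Fin nc → ℝ)),
        CascadeControl.IsCascadeSolution f g fc gc hc
            (CascadeControl.desiredSurrogate f g fc gc hc Q c dc σ) x₀ ⊤ X →
          Filter.Tendsto
            (fun t => CascadeControl.cost Q c (X t).1 (hc (X t).2)
              - CascadeControl.cost Q c (X t).1 (CascadeControl.desiredControl Q c (X t)))
            Filter.atTop (𝓝 0)) ∧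
    -- identity of the controls for matching initial data
    (∀ (x₀ : (Fin n → ℝ) × (Fin nc → ℝ)) (T : EReal) (X : ℝ → (Fin n → ℝ) × (Fin nc → ℝ)),
      CascadeControl.IsCascadeSolution f g fc gc hc
          (CascadeControl.desiredSurrogate f g fc gc hc Q c dc σ) x₀ T X →
        (∀ i : ℕ, i < dc →
          (CascadeControl.lieDeriv fc)^[i] hc x₀.2 =
            (CascadeControl.lieDeriv (CascadeControl.cascadeDrift f g fc hc))^[i]
              (CascadeControl.desiredControl Q c) x₀) →
        ∀ t ∈ CascadeControl.timeInterval T,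
          hc (X t).2 = CascadeControl.desiredControl Q c (X t)) := by
  exact mainTheorem7_general n nc m dc f g fc gc hc Q c σ (fun x => (hQpos x).isHermitian)
    (fun x => (hQpos x).isUnit) hfs hgs hfcs hhcs huds hrel hσ
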